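/- Let $\gamma>0$ and let $\Theta=\ell^2$ be the space of real sequences $\theta=(\theta_1,\theta_2,\dots)$ with $\|\theta\|_2=(\sum_i\theta_i^2)^{1/2}<\infty$; write $\theta_{(n)}=(\theta_1,\dots,\theta_n)$. For each $n$ let $\Sigma_{(n)}$ be a known positive definite $n\times n$ matrix, and let $p^{(n)}_{\theta}$ be the density of $N(\theta_{(n)},\Sigma_{(n)})$ on $\mathbb R^n$. Assume: (a) there are constants $a_1,a_2>0$ such that $a_1 n\sum_{i=1}^n\alpha_i^2\le \alpha\Sigma_{(n)}^{-1}\alpha^T\le a_2 n\sum_{i=1}^n\alpha_i^2$ for all $n$ and all $\alpha\in\mathbb R^n$; (b) $\theta_0\in\Theta$ satisfies $\sum_{i=1}^\infty\theta_{0,i}^2\,i^{2\gamma}<\infty$. Then there is a constant $c>0$ such that, with $k=k_n=\lfloor c\,n^{1/(2\gamma+1)}\rfloor$, the following holds. Let $\Sigma_k$ be positive definite $k\times k$ matrices such that (c) for some constant $C>0$, $\alpha\Sigma_k^{-1}\alpha^T\le C\,k\sum_{i=1}^k\alpha_i^2\,i^{2\gamma}$ for all $k=k_n$ ($n\ge 1$)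 and all $\alpha\in\mathbb R^k$, and let the prior $\Pi_n$ on $\Theta$ be the law of $\theta$ when $(\theta_1,\dots,\theta_k)\sim N(0,\Sigma_k)$ and $\theta_i=0$ for $i>k$. Then there is a constant $r>0$ such that, whenever $X^{(n)}\sim N(\theta_{0,(n)},\Sigma_{(n)})$, $n=1,2,\dots$, are random vectors on a common probability space (with any joint distribution, for instance independent), the posterior distributions $$\Pi_n(B\mid X^{(n)})=\frac{\int_B p_\theta^{(n)}(X^{(n)})\,\Pi_n(d\theta)}{\int_\Theta p_\theta^{(n)}(X^{(n)})\,\Pi_n(d\theta)}$$ satisfy, with $\varepsilon_n=n^{-\gamma/(2\gamma+1)}$, $$\Pi_n\bigl(\theta\in\Theta:\ \|\theta-\theta_0\|_2\ge r\,\varepsilon_n\mid X^{(n)}\bigr)\longrightarrow 0\quad\text{almost surely as } n\to\infty.$$ -/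

import Mathlib

open MeasureTheory ProbabilityTheory Filter Topology Matrix
open scoped ENNReal

namespace InfNormal

noncomputable section

/-- The parameter space `Θ = ℓ²` of square-summable real sequences. The coordinate of index
`i : ℕ` is the `(i + 1)`-st coordinate in one-based numbering. -/
abbrev Param : Type := lp (fun _ : ℕ => ℝ) 2

/-- `Θ` carries its Borel σ-algebra. -/
instance instMeasurableSpaceParam : MeasurableSpace Param := borel Param

instance instBorelSpaceParam : BorelSpace Param := ⟨rfl⟩

/-- The vector `θ_(n)` of the first `n` coordinates of `θ`. -/
def trunc (n : ℕ) (θ : Param) : EuclideanSpace ℝ (Fin n) :=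
  WithLp.toLp 2 (fun i : Fin n => θ (i : ℕ))

/-- The embedding of `ℝᵏ` in `Θ` that pads a vector with zeros. -/
def pad (k : ℕ) : EuclideanSpace ℝ (Fin k) →L[ℝ] Param :=
  ∑ i : Fin k, (lp.singleContinuousLinearMap ℝ (fun _ : ℕ => ℝ) 2 (i : ℕ)).comp
    (EuclideanSpace.proj i : EuclideanSpace ℝ (Fin k) →L[ℝ] ℝ)

/-- The quadratic form `α S⁻¹ αᵀ`. -/
def precForm {n : ℕ} (S : Matrix (Fin n) (Fin n) ℝ) (α : Fin n → ℝ) : ℝ :=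
  α ⬝ᵥ (S⁻¹ *ᵥ α)

/-- The Lebesgue density at `x` of the normal distribution `N(m, S)` on `ℝⁿ`, for positive
definite `S`. -/
def gaussDensity {n : ℕ} (m : EuclideanSpace ℝ (Fin n)) (S : Matrix (Fin n) (Fin n) ℝ)
    (x : EuclideanSpace ℝ (Fin n)) : ℝ :=
  (Real.sqrt ((2 * Real.pi) ^ n * S.det))⁻¹ * Real.exp (-(1 / 2) * precForm S (x - m).ofLp)

/-- The prior: the first `k` coordinates of `θ` have the law `N(0, S)`, the others are `0`. -/
def prior (k : ℕ) (S : Matrix (Fin k) (Fin k) ℝ) : Measure Param :=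
  (multivariateGaussian (0 : EuclideanSpace ℝ (Fin k)) S).map (pad k)

/-- The posterior mass of `B` given `x`, for the prior `Pr` and the observation `x` from the model
`N(θ_(n), S)`, `θ ∈ Θ`, by Bayes' formula. -/
def bayesPosterior {n : ℕ} (S : Matrix (Fin n) (Fin n) ℝ) (Pr : Measure Param)
    (x : EuclideanSpace ℝ (Fin n)) (B : Set Param) : ℝ≥0∞ :=
  (∫⁻ θ in B, ENNReal.ofReal (gaussDensity (trunc n θ) S x) ∂Pr) /
    (∫⁻ θ, ENNReal.ofReal (gaussDensity (trunc n θ) S x) ∂Pr)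

/-- The number `k = ⌊c n^{1/(2γ+1)}⌋` of coordinates on which the prior lives. -/
def priorDim (γ c : ℝ) (n : ℕ) : ℕ := ⌊(n : ℝ) ^ (1 / (2 * γ + 1)) * c⌋₊

/-- The rate `ε_n = n^{-γ/(2γ+1)}`. -/
def rate (γ : ℝ) (n : ℕ) : ℝ := (n : ℝ) ^ (-γ / (2 * γ + 1))

/-- Condition (a): `α Σ_(n)⁻¹ αᵀ ≈ n ∑ α_i²`, with constants independent of `n` and `α`. -/
def CondA (Sig : (n : ℕ) → Matrix (Fin n) (Fin n) ℝ) : Prop :=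
  ∃ a₁ > (0 : ℝ), ∃ a₂ > (0 : ℝ), ∀ (n : ℕ) (α : Fin n → ℝ),
    a₁ * (n * ∑ i, α i ^ 2) ≤ precForm (Sig n) α ∧
      precForm (Sig n) α ≤ a₂ * (n * ∑ i, α i ^ 2)

/-- Condition (b): `∑ θ_{0,i}² i^{2γ} < ∞`. -/
def CondB (γ : ℝ) (θ₀ : Param) : Prop :=
  Summable fun i : ℕ => θ₀ i ^ 2 * ((i : ℝ) + 1) ^ (2 * γ)

/-- Condition (c): `α Σ_k⁻¹ αᵀ ≲ k ∑ α_i² i^{2γ}`, with a constant independent of `k` and `α`,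
for all dimensions `k = ⌊c n^{1/(2γ+1)}⌋` that occur. -/
def CondC (γ c : ℝ) (S : (k : ℕ) → Matrix (Fin k) (Fin k) ℝ) : Prop :=
  ∃ C > (0 : ℝ), ∀ (n : ℕ) (α : Fin (priorDim γ c n) → ℝ),
    precForm (S (priorDim γ c n)) α ≤
      C * (priorDim γ c n * ∑ i, α i ^ 2 * ((i : ℕ) + 1 : ℝ) ^ (2 * γ))

end

end InfNormal

open InfNormal

/-!
Whitening the noise by `Σ_(n)^{-1/2}` and the prior by `Σ_k^{-1/2}` turns the experiment into the
linear model `y = G z + w` with `z` and `w` standard normal. The data really follow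
`y = G z₀ + b + w`, where `b` comes from the coordinates of `θ₀` that the prior sets to zero.
Completing the square, the posterior of `z` is normal with mean `K y`, `K = (1 + G* G)⁻¹ G*`, and
precision `1 + G* G`. The quadratic form of this precision therefore has a chi-square distribution
with `k` degrees of freedom under the posterior, which bounds the posterior spread whatever the data
are. The noise enters the posterior mean through `G K w`, the image of a standard normal vector
under a contraction of rank at most `k`, so the same chi-square bound applies to it. The bias is
bounded by pairing the normal equation with its solution. With `k ≍ n^{1/(2γ+1)}` all three
contributions are of order `ε_n`, and the exceptional probabilities `exp(-c n^{1/(2γ+1)})` are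
summable, so Borel–Cantelli applies.
-/

namespace InfNormal

section Chernoff

/-- Chernoff's bound, with parameter `s < 1/2`, on the probability that a chi-square variable with
`d` degrees of freedom is at least `ρ`. -/
noncomputable def chiSqTail (d : ℕ) (s ρ : ℝ) : ℝ :=
  (1 - 2 * s) ^ (-((d : ℝ) / 2)) * Real.exp (-(s * ρ))

lemma chiSqTail_mono_left {d e : ℕ} (hde : d ≤ e) {s : ℝ} (hs₀ : 0 ≤ s) (hs : s < 1 / 2) (ρ : ℝ) :
    chiSqTail d s ρ ≤ chiSqTail e s ρ := by
  unfold chiSqTail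
  gcongr ?_ * _
  refine Real.rpow_le_rpow_of_exponent_ge (by linarith) (by linarith) ?_
  gcongr

lemma chiSqTail_le_exp_neg {d : ℕ} {x : ℝ} (hd : d ≤ x) :
    chiSqTail d (1 / 4) (8 * x) ≤ Real.exp (-x) := by
  have h_two : (2 : ℝ) ≤ Real.exp 1 := by linarith [Real.add_one_le_exp (1 : ℝ)]
  calc chiSqTail d (1 / 4) (8 * x)
      = (2 : ℝ) ^ ((d : ℝ) / 2) * Real.exp (-(2 * x)) := by
        rw [chiSqTail, Real.rpow_neg (by norm_num), ← Real.inv_rpow (by norm_num)]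
        congr 2 <;> [norm_num; ring]
    _ ≤ Real.exp 1 ^ ((d : ℝ) / 2) * Real.exp (-(2 * x)) := by gcongr
    _ = Real.exp ((d : ℝ) / 2 - 2 * x) := by
        rw [Real.exp_one_rpow, ← Real.exp_add, sub_eq_add_neg]
    _ ≤ Real.exp (-x) := by
        have : (0 : ℝ) ≤ d := d.cast_nonneg
        gcongr
        linarith

lemma measure_le_ofReal_exp_mul_lintegral {α : Type*} [MeasurableSpace α] (μ : Measure α)
    {f : α → ℝ} (hf : Measurable f) {s : ℝ} (hs : 0 ≤ s) (ρ : ℝ) :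
    μ {x | ρ ≤ f x} ≤
      ENNReal.ofReal (Real.exp (-(s * ρ))) * ∫⁻ x, ENNReal.ofReal (Real.exp (s * f x)) ∂μ := by
  calc μ {x | ρ ≤ f x}
      ≤ μ {x | ENNReal.ofReal (Real.exp (s * ρ)) ≤ ENNReal.ofReal (Real.exp (s * f x))} :=
        measure_mono fun x hx => ENNReal.ofReal_le_ofReal <| Real.exp_le_exp.2 <|
          mul_le_mul_of_nonneg_left hx hs
    _ ≤ (∫⁻ x, ENNReal.ofReal (Real.exp (s * f x)) ∂μ) / ENNReal.ofReal (Real.exp (s * ρ)) :=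
        meas_ge_le_lintegral_div (by fun_prop) (by simp [Real.exp_pos]) ENNReal.ofReal_ne_top
    _ = _ := by
        rw [div_eq_mul_inv, mul_comm, Real.exp_neg, ENNReal.ofReal_inv_of_pos (Real.exp_pos _)]

end Chernoff

section NormalEquation

variable {V W : Type*} [NormedAddCommGroup V] [InnerProductSpace ℝ V] [CompleteSpace V]
  [NormedAddCommGroup W] [InnerProductSpace ℝ W] [CompleteSpace W] (G : V →L[ℝ] W)

/-- The quadratic form of the posterior precision `1 + G* G` in the linear model `y = G z + noise`
with standard normal noise and a standard normal prior on `z`. -/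
def posteriorForm {V W : Type*} [NormedAddCommGroup V] [InnerProductSpace ℝ V]
    [NormedAddCommGroup W] [InnerProductSpace ℝ W] (G : V →L[ℝ] W) (z : V) : ℝ :=
  ‖z‖ ^ 2 + ‖G z‖ ^ 2

/-- The posterior mean `(1 + G* G)⁻¹ G* y` in the linear model `y = G z + noise` with standard
normal noise and a standard normal prior on `z`. -/
noncomputable def posteriorMean : W →L[ℝ] V :=
  Ring.inverse (1 + G.adjoint.comp G) ∘L G.adjoint

lemma inner_add_adjoint_apply_self (z : V) :
    inner ℝ (z + G.adjoint (G z)) z = posteriorForm G z := by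
  rw [inner_add_left, ContinuousLinearMap.adjoint_inner_left, real_inner_self_eq_norm_sq,
    real_inner_self_eq_norm_sq, posteriorForm]

lemma isUnit_one_add_adjoint_comp_self : IsUnit (1 + G.adjoint.comp G) := by
  refine ContinuousLinearMap.isUnit_of_forall_le_norm_inner_map _ one_pos fun z => ?_
  have h_inner : inner ℝ ((1 + G.adjoint.comp G) z) z = posteriorForm G z :=
    inner_add_adjoint_apply_self G z
  rw [h_inner, NNReal.coe_one, mul_one, posteriorForm, Real.norm_of_nonneg (by positivity)]
  exact le_add_of_nonneg_right (sq_nonneg _)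

lemma posteriorMean_add_adjoint_apply (y : W) :
    posteriorMean G y + G.adjoint (G (posteriorMean G y)) = G.adjoint y := by
  have h := Ring.mul_inverse_cancel _ (isUnit_one_add_adjoint_comp_self G)
  exact congrArg (fun A : V →L[ℝ] V => A (G.adjoint y)) h

lemma posteriorForm_le_of_add_adjoint_eq {u a : V} {b : W}
    (h : u + G.adjoint (G u) = a + G.adjoint b) :
    posteriorForm G u ≤ ‖a‖ ^ 2 + ‖b‖ ^ 2 := by
  have h_inner : posteriorForm G u = inner ℝ a u + inner ℝ b (G u) := by
    rw [← inner_add_adjoint_apply_self, h, inner_add_left, ContinuousLinearMap.adjoint_inner_left]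
  have ha : inner ℝ a u ≤ ‖a‖ * ‖u‖ := real_inner_le_norm a u
  have hb : inner ℝ b (G u) ≤ ‖b‖ * ‖G u‖ := real_inner_le_norm b (G u)
  unfold posteriorForm at *
  linarith [two_mul_le_add_sq ‖a‖ ‖u‖, two_mul_le_add_sq ‖b‖ ‖G u‖]

lemma norm_comp_posteriorMean_le_one : ‖G.comp (posteriorMean G)‖ ≤ 1 := by
  refine ContinuousLinearMap.opNorm_le_bound _ zero_le_one fun w => ?_
  have h : posteriorForm G (posteriorMean G w) ≤ ‖(0 : V)‖ ^ 2 + ‖w‖ ^ 2 :=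
    posteriorForm_le_of_add_adjoint_eq G (by rw [zero_add, posteriorMean_add_adjoint_apply])
  rw [posteriorForm, norm_zero] at h
  rw [one_mul, ContinuousLinearMap.comp_apply]
  exact le_of_sq_le_sq (by linarith [sq_nonneg ‖posteriorMean G w‖]) (norm_nonneg w)

lemma norm_apply_posteriorMean_sub_le (z₀ : V) (b : W) :
    ‖G (posteriorMean G (G z₀ + b) - z₀)‖ ≤ ‖z₀‖ + ‖b‖ := by
  set u := posteriorMean G (G z₀ + b) - z₀
  have h_normal : u + G.adjoint (G u) = -z₀ + G.adjoint b := by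
    have h := posteriorMean_add_adjoint_apply G (G z₀ + b)
    rw [map_add G.adjoint] at h
    simp only [u, map_sub]
    rw [sub_add_sub_comm, h]
    abel
  have h := posteriorForm_le_of_add_adjoint_eq G h_normal
  rw [posteriorForm, norm_neg] at h
  refine le_of_sq_le_sq ?_ (by positivity)
  nlinarith [sq_nonneg ‖u‖, norm_nonneg z₀, norm_nonneg b]

lemma norm_sq_add_norm_sub_sq_eq_posteriorForm_add (y : W) (z : V) :
    ‖z‖ ^ 2 + ‖y - G z‖ ^ 2 = posteriorForm G (z - posteriorMean G y) +
      (‖posteriorMean G y‖ ^ 2 + ‖y - G (posteriorMean G y)‖ ^ 2) := by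
  set m := posteriorMean G y
  have h_cross : inner ℝ m (z - m) = inner ℝ (y - G m) (G (z - m)) := by
    have h := congrArg (inner ℝ · (z - m)) (posteriorMean_add_adjoint_apply G y)
    simp only [inner_add_left, ContinuousLinearMap.adjoint_inner_left] at h
    rw [inner_sub_left]
    linarith
  have h_prior : ‖z‖ ^ 2 = ‖m‖ ^ 2 + 2 * inner ℝ m (z - m) + ‖z - m‖ ^ 2 := by
    rw [← norm_add_sq_real, add_sub_cancel]
  have h_fit : ‖y - G z‖ ^ 2 =
      ‖y - G m‖ ^ 2 - 2 * inner ℝ (y - G m) (G (z - m)) + ‖G (z - m)‖ ^ 2 := by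
    rw [← norm_sub_sq_real, map_sub, sub_sub_sub_cancel_right]
  rw [h_prior, h_fit, h_cross, posteriorForm]
  ring

end NormalEquation

section StdGaussian

variable {V W : Type*} [NormedAddCommGroup V] [InnerProductSpace ℝ V] [FiniteDimensional ℝ V]
  [MeasurableSpace V] [BorelSpace V] [NormedAddCommGroup W] [InnerProductSpace ℝ W]
  [FiniteDimensional ℝ W] [MeasurableSpace W] [BorelSpace W]

variable (V) in
lemma integrable_exp_neg_half_mul_norm_sq :
    Integrable fun x : V => Real.exp (-(1 / 2) * ‖x‖ ^ 2) := by
  have h := (GaussianFourier.integrable_cexp_neg_mul_sq_norm_add (V := V) (b := (1 / 2 : ℂ))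
    (by norm_num) 0 0).norm
  refine h.congr (Eventually.of_forall fun x => ?_)
  simp [Complex.norm_exp, ← Complex.ofReal_pow]

variable (V) in
lemma stdGaussian_eq_withDensity :
    stdGaussian V = volume.withDensity fun x => ENNReal.ofReal
      ((2 * Real.pi) ^ (-((Module.finrank ℝ V : ℝ) / 2)) * Real.exp (-(1 / 2) * ‖x‖ ^ 2)) := by
  set c : ℝ := (2 * Real.pi) ^ (-((Module.finrank ℝ V : ℝ) / 2)) with hc
  have : 0 ≤ c := by positivity
  have := isFiniteMeasure_withDensity_ofReal
    ((integrable_exp_neg_half_mul_norm_sq V).const_mul c).hasFiniteIntegral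
  have h_const : (c : ℂ) * ((Real.pi : ℂ) / (1 / 2)) ^ ((Module.finrank ℝ V : ℂ) / 2) = 1 := by
    have h_base : (Real.pi : ℂ) / (1 / 2) = ((2 * Real.pi : ℝ) : ℂ) := by push_cast; ring
    have h_exponent : (Module.finrank ℝ V : ℂ) / 2 =
        (((Module.finrank ℝ V : ℝ) / 2 : ℝ) : ℂ) := by push_cast; ring
    rw [h_base, h_exponent, ← Complex.ofReal_cpow (by positivity), ← Complex.ofReal_mul, hc,
      Real.rpow_neg (by positivity), inv_mul_cancel₀ (by positivity), Complex.ofReal_one]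
  apply Measure.ext_of_charFun
  ext t
  have h_integrand (x : V) :
      (ENNReal.ofReal (c * Real.exp (-(1 / 2) * ‖x‖ ^ 2))).toReal •
        Complex.exp ((inner ℝ x t : ℝ) * Complex.I) =
      (c : ℂ) * Complex.exp (-(1 / 2) * ‖x‖ ^ 2 + Complex.I * (inner ℝ t x : ℝ)) := by
    rw [ENNReal.toReal_ofReal (by positivity), Complex.real_smul, Complex.ofReal_mul, mul_assoc,
      Complex.ofReal_exp, ← Complex.exp_add, real_inner_comm, mul_comm Complex.I]
    push_cast
    rfl
  rw [charFun_stdGaussian, charFun_apply, integral_withDensity_eq_integral_toReal_smul₀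
    (by fun_prop) (by simp)]
  simp_rw [h_integrand]
  rw [integral_const_mul, GaussianFourier.integral_cexp_neg_mul_sq_norm_add (by norm_num),
    ← mul_assoc, h_const, one_mul, Complex.I_sq]
  congr 1
  ring

lemma lintegral_stdGaussian (f : V → ℝ≥0∞) :
    ∫⁻ x, f x ∂stdGaussian V =
      ENNReal.ofReal ((2 * Real.pi) ^ (-((Module.finrank ℝ V : ℝ) / 2))) *
        ∫⁻ x, ENNReal.ofReal (Real.exp (-(1 / 2) * ‖x‖ ^ 2)) * f x := by
  rw [stdGaussian_eq_withDensity, lintegral_withDensity_eq_lintegral_mul_non_measurable _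
    (by fun_prop) (by simp), ← lintegral_const_mul' _ _ ENNReal.ofReal_ne_top]
  refine lintegral_congr fun x => ?_
  rw [Pi.mul_apply, ENNReal.ofReal_mul (by positivity), mul_assoc]

lemma lintegral_comp_mul_of_homogeneous (F : ℝ → ℝ≥0∞) {q : V → ℝ}
    (hq : ∀ (a : ℝ) x, q (a • x) = a ^ 2 * q x) {t : ℝ} (ht : 0 < t) :
    ∫⁻ x, F (t * q x) =
      ENNReal.ofReal (t ^ (-((Module.finrank ℝ V : ℝ) / 2))) * ∫⁻ x, F (q x) := by
  have h_unit : √t ≠ 0 := (Real.sqrt_pos.2 ht).ne'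
  have h_scale : t ^ (-((Module.finrank ℝ V : ℝ) / 2)) = |(√t ^ Module.finrank ℝ V)⁻¹| := by
    rw [abs_of_pos (by positivity), Real.rpow_neg ht.le, Real.sqrt_eq_rpow,
      ← Real.rpow_mul_natCast ht.le, one_div_mul_eq_div]
  calc ∫⁻ x, F (t * q x)
      = ∫⁻ x, F (q (√t • x)) := by simp_rw [hq, Real.sq_sqrt ht.le]
    _ = ∫⁻ x, F (q x) ∂(volume.map (MeasurableEquiv.smul₀ √t h_unit)) :=
        (lintegral_map_equiv (fun x => F (q x)) (MeasurableEquiv.smul₀ (√t) h_unit)).symm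
    _ = _ := by
        rw [MeasurableEquiv.coe_smul₀, Measure.map_addHaar_smul _ h_unit, lintegral_smul_measure,
          h_scale, smul_eq_mul]

/-- The prior `N(0, 1)` on `z` weighted by the likelihood of the observation `y = G z + noise`,
where the noise is standard normal. The normalizing constants of the likelihood and of the
posterior distribution are left out. -/
noncomputable def posteriorWeight (G : V →L[ℝ] W) (y : W) : Measure V :=
  (stdGaussian V).withDensity fun z => ENNReal.ofReal (Real.exp (-(1 / 2) * ‖y - G z‖ ^ 2))

lemma lintegral_exp_mul_posteriorForm_eq_volume (G : V →L[ℝ] W) (y : W) :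
    ∃ κ : ℝ≥0∞, ∀ s : ℝ,
      ∫⁻ z, ENNReal.ofReal (Real.exp (s * posteriorForm G (z - posteriorMean G y)))
          ∂posteriorWeight G y =
        κ * ∫⁻ z, ENNReal.ofReal (Real.exp (-((1 - 2 * s) * (posteriorForm G z / 2)))) := by
  set m := posteriorMean G y
  set κ₀ := Real.exp (-(1 / 2) * (‖m‖ ^ 2 + ‖y - G m‖ ^ 2))
  refine ⟨ENNReal.ofReal ((2 * Real.pi) ^ (-((Module.finrank ℝ V : ℝ) / 2))) *
    ENNReal.ofReal κ₀, fun s => ?_⟩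
  have h_integrand (z : V) :
      ENNReal.ofReal (Real.exp (-(1 / 2) * ‖z‖ ^ 2)) *
        (ENNReal.ofReal (Real.exp (-(1 / 2) * ‖y - G z‖ ^ 2)) *
          ENNReal.ofReal (Real.exp (s * posteriorForm G (z - m)))) =
      ENNReal.ofReal κ₀ *
        ENNReal.ofReal (Real.exp (-((1 - 2 * s) * (posteriorForm G (z - m) / 2)))) := by
    simp only [κ₀, ← ENNReal.ofReal_mul (Real.exp_pos _).le, ← Real.exp_add]
    congr 2
    linear_combination (-1 / 2) * norm_sq_add_norm_sub_sq_eq_posteriorForm_add G y z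
  rw [posteriorWeight, lintegral_withDensity_eq_lintegral_mul_non_measurable _
    (by fun_prop) (by simp), lintegral_stdGaussian]
  simp_rw [Pi.mul_apply, h_integrand]
  rw [lintegral_const_mul' _ _ ENNReal.ofReal_ne_top, mul_assoc,
    lintegral_sub_right_eq_self
      (fun z => ENNReal.ofReal (Real.exp (-((1 - 2 * s) * (posteriorForm G z / 2)))))]

lemma lintegral_exp_mul_posteriorForm (G : V →L[ℝ] W) (y : W) {s : ℝ} (hs : s < 1 / 2) :
    ∫⁻ z, ENNReal.ofReal (Real.exp (s * posteriorForm G (z - posteriorMean G y)))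
        ∂posteriorWeight G y =
      ENNReal.ofReal ((1 - 2 * s) ^ (-((Module.finrank ℝ V : ℝ) / 2))) *
        posteriorWeight G y Set.univ := by
  obtain ⟨κ, hκ⟩ := lintegral_exp_mul_posteriorForm_eq_volume G y
  have h_mass : posteriorWeight G y Set.univ =
      κ * ∫⁻ z, ENNReal.ofReal (Real.exp (-(posteriorForm G z / 2))) := by
    simpa using hκ 0
  have h_homogeneous (a : ℝ) (z : V) :
      posteriorForm G (a • z) / 2 = a ^ 2 * (posteriorForm G z / 2) := by
    simp only [posteriorForm, map_smul, norm_smul, mul_pow, Real.norm_eq_abs, sq_abs]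
    ring
  rw [hκ, h_mass, lintegral_comp_mul_of_homogeneous (fun r => ENNReal.ofReal (Real.exp (-r)))
    h_homogeneous (by linarith), mul_left_comm]

lemma posteriorWeight_posteriorForm_ge_le (G : V →L[ℝ] W) (y : W) {s : ℝ} (hs₀ : 0 ≤ s)
    (hs : s < 1 / 2) (ρ : ℝ) :
    posteriorWeight G y {z | ρ ≤ posteriorForm G (z - posteriorMean G y)} ≤
      ENNReal.ofReal (chiSqTail (Module.finrank ℝ V) s ρ) * posteriorWeight G y Set.univ := by
  refine (measure_le_ofReal_exp_mul_lintegral _ (by unfold posteriorForm; fun_prop) hs₀ ρ).trans ?_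
  rw [lintegral_exp_mul_posteriorForm G y hs, ← mul_assoc,
    ← ENNReal.ofReal_mul (Real.exp_pos _).le, mul_comm (Real.exp _), chiSqTail]

lemma posteriorWeight_norm_sub_ge_le (G : V →L[ℝ] W) (z₀ : V) (b : W) {w : W} {s ρ : ℝ}
    (hs₀ : 0 ≤ s) (hs : s < 1 / 2) (hw : ‖G (posteriorMean G w)‖ ^ 2 ≤ ρ) :
    posteriorWeight G (G z₀ + b + w) {z | ‖z₀‖ + ‖b‖ + 2 * √ρ ≤ ‖G (z - z₀)‖} ≤
      ENNReal.ofReal (chiSqTail (Module.finrank ℝ V) s ρ) *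
        posteriorWeight G (G z₀ + b + w) Set.univ := by
  refine (measure_mono fun z (hz : ‖z₀‖ + ‖b‖ + 2 * √ρ ≤ ‖G (z - z₀)‖) => ?_).trans
    (posteriorWeight_posteriorForm_ge_le G _ hs₀ hs ρ)
  set m := posteriorMean G (G z₀ + b + w) with hm
  have h_split : G (z - z₀) =
      G (z - m) + G (posteriorMean G (G z₀ + b) - z₀) + G (posteriorMean G w) := by
    rw [← map_add, ← map_add, hm, map_add _ _ w]
    congr 1
    abel
  have h_bias := norm_apply_posteriorMean_sub_le G z₀ b
  have h_noise : ‖G (posteriorMean G w)‖ ≤ √ρ := Real.le_sqrt_of_sq_le hw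
  have h_spread : √ρ ≤ ‖G (z - m)‖ := by
    have := norm_add₃_le (a := G (z - m)) (b := G (posteriorMean G (G z₀ + b) - z₀))
      (c := G (posteriorMean G w))
    rw [← h_split] at this
    linarith
  calc ρ ≤ ‖G (z - m)‖ ^ 2 := (Real.sqrt_le_left (norm_nonneg _)).1 h_spread
    _ ≤ posteriorForm G (z - m) := le_add_of_nonneg_left (sq_nonneg _)

variable (V) in
lemma lintegral_exp_mul_norm_sq_stdGaussian {s : ℝ} (hs : s < 1 / 2) :
    ∫⁻ x, ENNReal.ofReal (Real.exp (s * ‖x‖ ^ 2)) ∂stdGaussian V =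
      ENNReal.ofReal ((1 - 2 * s) ^ (-((Module.finrank ℝ V : ℝ) / 2))) := by
  -- A standard normal law is the posterior in the experiment that observes nothing.
  simpa [posteriorForm, posteriorWeight] using
    lintegral_exp_mul_posteriorForm (0 : V →L[ℝ] V) 0 hs

lemma lintegral_exp_inner_stdGaussian (a : V) :
    ∫⁻ x, ENNReal.ofReal (Real.exp (inner ℝ a x)) ∂stdGaussian V =
      ENNReal.ofReal (Real.exp (‖a‖ ^ 2 / 2)) := by
  have h_map : (stdGaussian V).map (innerSL ℝ a) = gaussianReal 0 (‖a‖ ^ 2).toNNReal := by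
    rw [IsGaussian.map_eq_gaussianReal, integral_strongDual_stdGaussian,
      variance_dual_stdGaussian, innerSL_apply_norm]
  have h_mgf := congrFun (mgf_id_gaussianReal (μ := 0) (v := (‖a‖ ^ 2).toNNReal)) 1
  have h_int := integrable_exp_mul_gaussianReal (μ := 0) (v := (‖a‖ ^ 2).toNNReal) 1
  calc ∫⁻ x, ENNReal.ofReal (Real.exp (inner ℝ a x)) ∂stdGaussian V
      = ∫⁻ y, ENNReal.ofReal (Real.exp y) ∂(stdGaussian V).map (innerSL ℝ a) := by
        rw [lintegral_map (by fun_prop) (by fun_prop)]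
        simp only [innerSL_apply_apply]
    _ = ENNReal.ofReal (Real.exp (‖a‖ ^ 2 / 2)) := by
        rw [h_map, ← ofReal_integral_eq_lintegral_ofReal (by simpa using h_int)
          (Eventually.of_forall fun _ => (Real.exp_pos _).le)]
        congr 1
        simpa [mgf] using h_mgf

lemma lintegral_exp_inner_sqrt_smul_stdGaussian {s : ℝ} (hs : 0 ≤ s) (a : V) :
    ∫⁻ x, ENNReal.ofReal (Real.exp (inner ℝ (√(2 * s) • a) x)) ∂stdGaussian V =
      ENNReal.ofReal (Real.exp (s * ‖a‖ ^ 2)) := by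
  rw [lintegral_exp_inner_stdGaussian, norm_smul, mul_pow, Real.norm_eq_abs, sq_abs,
    Real.sq_sqrt (by positivity)]
  congr 2
  ring

lemma lintegral_exp_mul_norm_sq_comp_eq_adjoint (T : V →L[ℝ] W) {s : ℝ} (hs : 0 ≤ s) :
    ∫⁻ x, ENNReal.ofReal (Real.exp (s * ‖T x‖ ^ 2)) ∂stdGaussian V =
      ∫⁻ g, ENNReal.ofReal (Real.exp (s * ‖T.adjoint g‖ ^ 2)) ∂stdGaussian W := by
  have h_adjoint (x : V) (g : W) :
      inner ℝ (√(2 * s) • T x) g = inner ℝ (√(2 * s) • T.adjoint g) x := by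
    rw [real_inner_smul_left, real_inner_smul_left, ContinuousLinearMap.adjoint_inner_left,
      real_inner_comm]
  simp_rw [← lintegral_exp_inner_sqrt_smul_stdGaussian hs]
  rw [lintegral_lintegral_swap (by fun_prop)]
  simp_rw [h_adjoint]

lemma lintegral_exp_mul_norm_sq_comp_le (T : V →L[ℝ] W) (hT : ‖T‖ ≤ 1) {s : ℝ} (hs₀ : 0 ≤ s)
    (hs : s < 1 / 2) :
    ∫⁻ x, ENNReal.ofReal (Real.exp (s * ‖T x‖ ^ 2)) ∂stdGaussian V ≤
      ENNReal.ofReal ((1 - 2 * s) ^ (-((Module.finrank ℝ W : ℝ) / 2))) := by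
  rw [lintegral_exp_mul_norm_sq_comp_eq_adjoint T hs₀,
    ← lintegral_exp_mul_norm_sq_stdGaussian W hs]
  have h_adjoint (g : W) : ‖T.adjoint g‖ ≤ ‖g‖ := by
    refine T.adjoint.le_of_opNorm_le ?_ g |>.trans_eq (one_mul _)
    rwa [LinearIsometryEquiv.norm_map]
  gcongr with g
  exact h_adjoint g

end StdGaussian

lemma stdGaussian_norm_sq_comp_ge_le {V W : Type*} [NormedAddCommGroup V]
    [InnerProductSpace ℝ V] [FiniteDimensional ℝ V] [MeasurableSpace V] [BorelSpace V]
    [NormedAddCommGroup W] [InnerProductSpace ℝ W] [MeasurableSpace W] [BorelSpace W]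
    (T : V →L[ℝ] W) (hT : ‖T‖ ≤ 1) {s : ℝ} (hs₀ : 0 ≤ s) (hs : s < 1 / 2) (ρ : ℝ) :
    stdGaussian V {x | ρ ≤ ‖T x‖ ^ 2} ≤
      ENNReal.ofReal (chiSqTail (Module.finrank ℝ T.range) s ρ) := by
  have h_norm : ‖T.rangeRestrict‖ ≤ 1 :=
    ContinuousLinearMap.opNorm_le_bound _ zero_le_one fun x => T.le_of_opNorm_le hT x
  calc stdGaussian V {x | ρ ≤ ‖T x‖ ^ 2}
      ≤ ENNReal.ofReal (Real.exp (-(s * ρ))) *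
          ∫⁻ x, ENNReal.ofReal (Real.exp (s * ‖T.rangeRestrict x‖ ^ 2)) ∂stdGaussian V :=
        measure_le_ofReal_exp_mul_lintegral _ (by fun_prop) hs₀ ρ
    _ ≤ ENNReal.ofReal (Real.exp (-(s * ρ))) *
          ENNReal.ofReal ((1 - 2 * s) ^ (-((Module.finrank ℝ T.range : ℝ) / 2))) := by
        gcongr
        exact lintegral_exp_mul_norm_sq_comp_le T.rangeRestrict h_norm hs₀ hs
    _ = ENNReal.ofReal (chiSqTail (Module.finrank ℝ T.range) s ρ) := by
        rw [← ENNReal.ofReal_mul (Real.exp_pos _).le, mul_comm, chiSqTail]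

section Whitening

open scoped MatrixOrder

variable {ι : Type*} [Fintype ι] [DecidableEq ι] {S : Matrix ι ι ℝ}

/-- Multiplication by `S^{1/2}`, which maps standard normal vectors to `N(0, S)` vectors. -/
noncomputable def sqrtCLM (S : Matrix ι ι ℝ) : EuclideanSpace ℝ ι →L[ℝ] EuclideanSpace ℝ ι :=
  toEuclideanCLM (𝕜 := ℝ) (CFC.sqrt S)

/-- Multiplication by `S^{-1/2}`, which maps `N(0, S)` vectors to standard normal vectors. -/
noncomputable def whitening (S : Matrix ι ι ℝ) : EuclideanSpace ℝ ι →L[ℝ] EuclideanSpace ℝ ι :=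
  toEuclideanCLM (𝕜 := ℝ) (CFC.sqrt S)⁻¹

lemma isUnit_det_sqrt (hS : S.PosDef) : IsUnit (CFC.sqrt S).det :=
  (Matrix.isUnit_iff_isUnit_det _).1 <|
    (CFC.isUnit_sqrt_iff S hS.posSemidef.nonneg).2 hS.isUnit

lemma whitening_sqrtCLM (hS : S.PosDef) (x : EuclideanSpace ℝ ι) :
    whitening S (sqrtCLM S x) = x := by
  rw [whitening, sqrtCLM, ← mul_apply_eq_comp, ← map_mul,
    Matrix.nonsing_inv_mul _ (isUnit_det_sqrt hS), map_one]
  rfl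

lemma sqrtCLM_whitening (hS : S.PosDef) (x : EuclideanSpace ℝ ι) :
    sqrtCLM S (whitening S x) = x := by
  rw [whitening, sqrtCLM, ← mul_apply_eq_comp, ← map_mul,
    Matrix.mul_nonsing_inv _ (isUnit_det_sqrt hS), map_one]
  rfl

lemma inv_sqrt_transpose (S : Matrix ι ι ℝ) : ((CFC.sqrt S)⁻¹)ᵀ = (CFC.sqrt S)⁻¹ := by
  have h : (CFC.sqrt S)ᴴ = CFC.sqrt S := (CFC.sqrt_nonneg S).isSelfAdjoint
  rw [Matrix.transpose_nonsing_inv, ← Matrix.conjTranspose_eq_transpose_of_trivial, h]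

lemma norm_whitening_sq {n : ℕ} {S : Matrix (Fin n) (Fin n) ℝ} (hS : S.PosDef)
    (x : EuclideanSpace ℝ (Fin n)) : ‖whitening S x‖ ^ 2 = precForm S x.ofLp := by
  have h_inv : S⁻¹ = (CFC.sqrt S)⁻¹ * (CFC.sqrt S)⁻¹ := by
    rw [← Matrix.mul_inv_rev, CFC.sqrt_mul_sqrt_self S hS.posSemidef.nonneg]
  have h_whitening : (whitening S x).ofLp = (CFC.sqrt S)⁻¹ *ᵥ x.ofLp := rfl
  rw [precForm, h_inv, ← Matrix.mulVec_mulVec, Matrix.dotProduct_mulVec,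
    ← Matrix.mulVec_transpose, inv_sqrt_transpose, EuclideanSpace.real_norm_sq_eq, h_whitening]
  simp only [dotProduct, sq]

lemma norm_whitening {n : ℕ} {S : Matrix (Fin n) (Fin n) ℝ} (hS : S.PosDef)
    (x : EuclideanSpace ℝ (Fin n)) : ‖whitening S x‖ = √(precForm S x.ofLp) := by
  rw [← norm_whitening_sq hS, Real.sqrt_sq (norm_nonneg _)]

lemma hasLaw_whitening_sub {Ω : Type*} [MeasurableSpace Ω] {P : Measure Ω}
    {μ : EuclideanSpace ℝ ι} (hS : S.PosDef) {X : Ω → EuclideanSpace ℝ ι}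
    (hX : HasLaw X (multivariateGaussian μ S) P) :
    HasLaw (fun ω => whitening S (X ω - μ)) (stdGaussian (EuclideanSpace ℝ ι)) P := by
  refine HasLaw.fun_comp (Y := fun x => whitening S (x - μ)) ⟨by fun_prop, ?_⟩ hX
  have h_law : multivariateGaussian μ S =
      (stdGaussian (EuclideanSpace ℝ ι)).map (fun x => μ + sqrtCLM S x) := rfl
  have h_inverse : (fun x => whitening S (x - μ)) ∘ (fun x => μ + sqrtCLM S x) = id := by
    ext1 x
    rw [Function.comp_apply, add_sub_cancel_left, whitening_sqrtCLM hS, id]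
  rw [h_law, Measure.map_map (by fun_prop) (by fun_prop), h_inverse, Measure.map_id]

end Whitening

section Coordinates

lemma pad_apply (k : ℕ) (u : EuclideanSpace ℝ (Fin k)) (j : ℕ) :
    pad k u j = if h : j < k then u ⟨j, h⟩ else 0 := by
  have h_sum : pad k u = ∑ i : Fin k, lp.single 2 (i : ℕ) (u i) := by
    simp [pad]
  rw [h_sum, lp.coeFn_sum, Finset.sum_apply]
  split_ifs with h
  · rw [Finset.sum_eq_single_of_mem ⟨j, h⟩ (Finset.mem_univ _)]
    · exact lp.single_apply_self ..
    · intro i _ hi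
      exact lp.single_apply_ne _ _ _ fun e => hi (Fin.ext e.symm)
  · exact Finset.sum_eq_zero fun i _ => lp.single_apply_ne _ _ _ (by omega)

lemma norm_trunc_sq (n : ℕ) (θ : Param) : ‖trunc n θ‖ ^ 2 = ∑ i ∈ Finset.range n, θ i ^ 2 := by
  rw [EuclideanSpace.real_norm_sq_eq, ← Fin.sum_univ_eq_sum_range (fun i => θ i ^ 2)]
  rfl

lemma hasSum_sq_norm_sq (θ : Param) : HasSum (fun i => θ i ^ 2) (‖θ‖ ^ 2) := by
  simpa using lp.hasSum_norm (by norm_num : 0 < (2 : ℝ≥0∞).toReal) θ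

lemma norm_trunc_le (n : ℕ) (θ : Param) : ‖trunc n θ‖ ≤ ‖θ‖ := by
  refine le_of_sq_le_sq ?_ (norm_nonneg _)
  rw [norm_trunc_sq]
  exact sum_le_hasSum _ (fun i _ => sq_nonneg _) (hasSum_sq_norm_sq θ)

lemma trunc_pad (k : ℕ) (u : EuclideanSpace ℝ (Fin k)) : trunc k (pad k u) = u := by
  ext i
  simp [trunc, pad_apply]

lemma norm_pad (k : ℕ) (u : EuclideanSpace ℝ (Fin k)) : ‖pad k u‖ = ‖u‖ := by
  have h_sum : HasSum (fun i => pad k u i ^ 2) (∑ i ∈ Finset.range k, pad k u i ^ 2) := by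
    refine hasSum_sum_of_ne_finset_zero fun i hi => ?_
    rw [pad_apply, dif_neg (by simpa using hi), sq, zero_mul]
  rw [← norm_trunc_sq, trunc_pad] at h_sum
  exact (sq_eq_sq₀ (norm_nonneg _) (norm_nonneg _)).1 ((hasSum_sq_norm_sq _).unique h_sum)

lemma norm_le_norm_trunc_pad {k n : ℕ} (hkn : k ≤ n) (u : EuclideanSpace ℝ (Fin k)) :
    ‖u‖ ≤ ‖trunc n (pad k u)‖ := by
  refine le_of_sq_le_sq ?_ (norm_nonneg _)
  conv_lhs => rw [← trunc_pad k u]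
  rw [norm_trunc_sq, norm_trunc_sq]
  exact Finset.sum_le_sum_of_subset_of_nonneg (Finset.range_mono hkn) fun i _ _ => sq_nonneg _

/-- `trunc` as a continuous linear map. -/
noncomputable def truncCLM (n : ℕ) : Param →L[ℝ] EuclideanSpace ℝ (Fin n) :=
  LinearMap.mkContinuous
    { toFun := trunc n
      map_add' := fun _ _ => rfl
      map_smul' := fun _ _ => rfl } 1
    fun θ => (norm_trunc_le n θ).trans_eq (one_mul _).symm

lemma truncCLM_apply (n : ℕ) (θ : Param) : truncCLM n θ = trunc n θ := rfl

/-- The part of `θ` that a prior on the first `k` coordinates cannot reach. -/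
noncomputable def truncError (k : ℕ) (θ : Param) : Param := θ - pad k (trunc k θ)

lemma truncError_apply (k : ℕ) (θ : Param) (i : ℕ) :
    truncError k θ i = if i < k then 0 else θ i := by
  rw [truncError, lp.coeFn_sub, Pi.sub_apply, pad_apply]
  split_ifs
  · exact sub_self _
  · exact sub_zero _

end Coordinates

section FiniteSample

variable {k n : ℕ} {Sn : Matrix (Fin n) (Fin n) ℝ} {S : Matrix (Fin k) (Fin k) ℝ}

/-- The mean of the whitened observation as a linear function of the whitened parameter. -/
noncomputable def design (Sn : Matrix (Fin n) (Fin n) ℝ) (S : Matrix (Fin k) (Fin k) ℝ) :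
    EuclideanSpace ℝ (Fin k) →L[ℝ] EuclideanSpace ℝ (Fin n) :=
  whitening Sn ∘L truncCLM n ∘L pad k ∘L sqrtCLM S

lemma prior_eq_map (k : ℕ) (S : Matrix (Fin k) (Fin k) ℝ) :
    prior k S = (stdGaussian (EuclideanSpace ℝ (Fin k))).map fun z => pad k (sqrtCLM S z) := by
  rw [prior, multivariateGaussian, Measure.map_map (by fun_prop) (by fun_prop)]
  simp only [zero_add, Function.comp_def, sqrtCLM]

lemma setLIntegral_gaussDensity_prior (hSn : Sn.PosDef) (S : Matrix (Fin k) (Fin k) ℝ)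
    (x : EuclideanSpace ℝ (Fin n)) {B : Set Param} (hB : MeasurableSet B) :
    ∫⁻ θ in B, ENNReal.ofReal (gaussDensity (trunc n θ) Sn x) ∂prior k S =
      ENNReal.ofReal (√((2 * Real.pi) ^ n * Sn.det))⁻¹ *
        posteriorWeight (design Sn S) (whitening Sn x) ((fun z => pad k (sqrtCLM S z)) ⁻¹' B) := by
  have h_density (θ : Param) : ENNReal.ofReal (gaussDensity (trunc n θ) Sn x) =
      ENNReal.ofReal (√((2 * Real.pi) ^ n * Sn.det))⁻¹ * ENNReal.ofReal
        (Real.exp (-(1 / 2) * ‖whitening Sn x - (whitening Sn ∘L truncCLM n) θ‖ ^ 2)) := by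
    rw [← ENNReal.ofReal_mul (by positivity), gaussDensity, ContinuousLinearMap.comp_apply,
      truncCLM_apply, ← map_sub, norm_whitening_sq hSn]
  have h_embed : Measurable fun z => pad k (sqrtCLM S z) := by fun_prop
  simp_rw [h_density]
  rw [lintegral_const_mul _ (by fun_prop), prior_eq_map, setLIntegral_map hB (by fun_prop) h_embed,
    posteriorWeight, withDensity_apply _ (h_embed hB)]
  rfl

lemma bayesPosterior_prior (hSn : Sn.PosDef) (S : Matrix (Fin k) (Fin k) ℝ)
    (x : EuclideanSpace ℝ (Fin n)) {B : Set Param} (hB : MeasurableSet B) :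
    bayesPosterior Sn (prior k S) x B =
      posteriorWeight (design Sn S) (whitening Sn x) ((fun z => pad k (sqrtCLM S z)) ⁻¹' B) /
        posteriorWeight (design Sn S) (whitening Sn x) Set.univ := by
  have h_const : ENNReal.ofReal (√((2 * Real.pi) ^ n * Sn.det))⁻¹ ≠ 0 := by
    have := hSn.det_pos
    exact (ENNReal.ofReal_pos.2 (by positivity)).ne'
  rw [bayesPosterior, ← setLIntegral_univ (μ := prior k S),
    setLIntegral_gaussDensity_prior hSn S x hB,
    setLIntegral_gaussDensity_prior hSn S x MeasurableSet.univ, Set.preimage_univ,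
    ENNReal.mul_div_mul_left _ _ h_const ENNReal.ofReal_ne_top]

lemma norm_pad_sqrtCLM_sub_le (hSn : Sn.PosDef) (hS : S.PosDef) (hkn : k ≤ n) {l : ℝ}
    (hl : 0 < l) (hSn_ge : ∀ α : Fin n → ℝ, l * ∑ i, α i ^ 2 ≤ precForm Sn α) (θ₀ : Param)
    (z : EuclideanSpace ℝ (Fin k)) :
    ‖pad k (sqrtCLM S z) - θ₀‖ ≤
      ‖truncError k θ₀‖ + ‖design Sn S (z - whitening S (trunc k θ₀))‖ / √l := by
  set u := z - whitening S (trunc k θ₀)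
  have h_split : pad k (sqrtCLM S z) - θ₀ = pad k (sqrtCLM S u) - truncError k θ₀ := by
    rw [map_sub (sqrtCLM S), sqrtCLM_whitening hS, map_sub, truncError]
    abel
  have h_lower (v : EuclideanSpace ℝ (Fin n)) : √l * ‖v‖ ≤ ‖whitening Sn v‖ := by
    rw [norm_whitening hSn, ← Real.sqrt_sq (norm_nonneg v), ← Real.sqrt_mul hl.le,
      EuclideanSpace.real_norm_sq_eq]
    exact Real.sqrt_le_sqrt (hSn_ge _)
  have h_design : ‖sqrtCLM S u‖ ≤ ‖design Sn S u‖ / √l := by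
    rw [le_div_iff₀' (Real.sqrt_pos.2 hl)]
    refine le_trans ?_ (h_lower _)
    gcongr
    exact norm_le_norm_trunc_pad hkn _
  calc ‖pad k (sqrtCLM S z) - θ₀‖
      ≤ ‖sqrtCLM S u‖ + ‖truncError k θ₀‖ := by
        rw [h_split, ← norm_pad k (sqrtCLM S u)]
        exact norm_sub_le _ _
    _ ≤ ‖truncError k θ₀‖ + ‖design Sn S u‖ / √l := by rw [add_comm]; gcongr

/-- The radius of a ball around `θ₀` that carries most of the posterior mass, when `l` is a lower
bound for the precision `Sn⁻¹` of the observation and `ρ` a high quantile of the chi-square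
distribution with `k` degrees of freedom. -/
noncomputable def oracleRadius (θ₀ : Param) (Sn : Matrix (Fin n) (Fin n) ℝ)
    (S : Matrix (Fin k) (Fin k) ℝ) (l ρ : ℝ) : ℝ :=
  ‖truncError k θ₀‖ + (√(precForm S (trunc k θ₀)) +
    √(precForm Sn (trunc n (truncError k θ₀))) + 2 * √ρ) / √l

lemma whitening_eq_design_add (Sn : Matrix (Fin n) (Fin n) ℝ) (hS : S.PosDef) (θ₀ : Param)
    (x : EuclideanSpace ℝ (Fin n)) :
    whitening Sn x = design Sn S (whitening S (trunc k θ₀)) +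
      whitening Sn (trunc n (truncError k θ₀)) + whitening Sn (x - trunc n θ₀) := by
  have h_design : design Sn S (whitening S (trunc k θ₀)) =
      whitening Sn (trunc n (pad k (trunc k θ₀))) := by
    conv_rhs => rw [← sqrtCLM_whitening hS (trunc k θ₀)]
    rfl
  rw [h_design, ← map_add, ← map_add]
  simp only [← truncCLM_apply n, truncError, map_sub]
  congr 1
  abel

lemma bayesPosterior_oracleRadius_le (hSn : Sn.PosDef) (hS : S.PosDef) (hkn : k ≤ n) {l : ℝ}
    (hl : 0 < l) (hSn_ge : ∀ α : Fin n → ℝ, l * ∑ i, α i ^ 2 ≤ precForm Sn α) {s ρ R : ℝ}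
    (hs₀ : 0 ≤ s) (hs : s < 1 / 2) {θ₀ : Param} (hR : oracleRadius θ₀ Sn S l ρ ≤ R)
    {x : EuclideanSpace ℝ (Fin n)}
    (hx : ‖design Sn S (posteriorMean (design Sn S) (whitening Sn (x - trunc n θ₀)))‖ ^ 2 ≤ ρ) :
    bayesPosterior Sn (prior k S) x {θ | R ≤ ‖θ - θ₀‖} ≤
      ENNReal.ofReal (chiSqTail k s ρ) := by
  set z₀ := whitening S (trunc k θ₀) with hz₀
  set b := whitening Sn (trunc n (truncError k θ₀)) with hb
  have h_far : (fun z => pad k (sqrtCLM S z)) ⁻¹' {θ | R ≤ ‖θ - θ₀‖} ⊆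
      {z | ‖z₀‖ + ‖b‖ + 2 * √ρ ≤ ‖design Sn S (z - z₀)‖} := by
    intro z (hz : R ≤ ‖pad k (sqrtCLM S z) - θ₀‖)
    have h_le := (hR.trans hz).trans (norm_pad_sqrtCLM_sub_le hSn hS hkn hl hSn_ge θ₀ z)
    rw [oracleRadius, add_le_add_iff_left, div_le_div_iff_of_pos_right (Real.sqrt_pos.2 hl),
      ← norm_whitening hS, ← norm_whitening hSn] at h_le
    exact h_le
  have h_contraction := posteriorWeight_norm_sub_ge_le (design Sn S) z₀ b hs₀ hs hx
  rw [hz₀, hb, ← whitening_eq_design_add Sn hS, finrank_euclideanSpace_fin] at h_contraction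
  rw [bayesPosterior_prior hSn S x (measurableSet_le measurable_const (by fun_prop))]
  exact ENNReal.div_le_of_le_mul ((measure_mono h_far).trans h_contraction)

lemma measure_chiSqTail_lt_bayesPosterior_le {Ω : Type*} [MeasurableSpace Ω] {P : Measure Ω}
    {X : Ω → EuclideanSpace ℝ (Fin n)} {θ₀ : Param} (hSn : Sn.PosDef) (hS : S.PosDef)
    (hkn : k ≤ n) {l : ℝ} (hl : 0 < l)
    (hSn_ge : ∀ α : Fin n → ℝ, l * ∑ i, α i ^ 2 ≤ precForm Sn α)
    (hX : HasLaw X (multivariateGaussian (trunc n θ₀) Sn) P) {s ρ R : ℝ} (hs₀ : 0 ≤ s)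
    (hs : s < 1 / 2) (hR : oracleRadius θ₀ Sn S l ρ ≤ R) :
    P {ω | ENNReal.ofReal (chiSqTail k s ρ) <
        bayesPosterior Sn (prior k S) (X ω) {θ | R ≤ ‖θ - θ₀‖}} ≤
      ENNReal.ofReal (chiSqTail k s ρ) := by
  set T := (design Sn S).comp (posteriorMean (design Sn S))
  have h_rank : Module.finrank ℝ T.range ≤ k := by
    have h_le : T.range ≤ (design Sn S).range := LinearMap.range_comp_le_range _ _
    calc Module.finrank ℝ T.range
        ≤ Module.finrank ℝ (design Sn S).range := Submodule.finrank_mono h_le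
      _ ≤ Module.finrank ℝ (EuclideanSpace ℝ (Fin k)) := LinearMap.finrank_range_le _
      _ = k := finrank_euclideanSpace_fin
  calc P {ω | ENNReal.ofReal (chiSqTail k s ρ) <
        bayesPosterior Sn (prior k S) (X ω) {θ | R ≤ ‖θ - θ₀‖}}
      ≤ P {ω | ρ ≤ ‖T (whitening Sn (X ω - trunc n θ₀))‖ ^ 2} :=
        measure_mono fun ω hω => le_of_not_ge fun h => not_le_of_gt hω <|
          bayesPosterior_oracleRadius_le hSn hS hkn hl hSn_ge hs₀ hs hR h
    _ = stdGaussian (EuclideanSpace ℝ (Fin n)) {w | ρ ≤ ‖T w‖ ^ 2} :=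
        (hasLaw_whitening_sub hSn hX).measure_eq (p := fun w => ρ ≤ ‖T w‖ ^ 2)
          (measurableSet_le measurable_const (by fun_prop))
    _ ≤ ENNReal.ofReal (chiSqTail (Module.finrank ℝ T.range) s ρ) :=
        stdGaussian_norm_sq_comp_ge_le T (norm_comp_posteriorMean_le_one _) hs₀ hs ρ
    _ ≤ ENNReal.ofReal (chiSqTail k s ρ) :=
        ENNReal.ofReal_le_ofReal (chiSqTail_mono_left h_rank hs₀ hs ρ)

end FiniteSample

section Rates

variable {γ c : ℝ} {k n : ℕ} {θ : Param}

/-- The squared Sobolev norm of order `γ` of a sequence, which is `0` by convention unless the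
sequence satisfies `CondB γ`. -/
noncomputable def sobolevEnergy (γ : ℝ) (θ : Param) : ℝ :=
  ∑' i : ℕ, θ i ^ 2 * ((i : ℝ) + 1) ^ (2 * γ)

lemma sobolevEnergy_nonneg (γ : ℝ) (θ : Param) : 0 ≤ sobolevEnergy γ θ :=
  tsum_nonneg fun _ => by positivity

lemma sum_trunc_le_sobolevEnergy (hθ : CondB γ θ) (k : ℕ) :
    ∑ i : Fin k, trunc k θ i ^ 2 * ((i : ℕ) + 1 : ℝ) ^ (2 * γ) ≤ sobolevEnergy γ θ :=
  (Fin.sum_univ_eq_sum_range (fun i : ℕ => θ i ^ 2 * ((i : ℝ) + 1) ^ (2 * γ)) k).trans_le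
    (hθ.sum_le_tsum _ fun _ _ => by positivity)

lemma norm_truncError_le (hγ : 0 ≤ γ) (hθ : CondB γ θ) {x : ℝ} (hx : 0 < x) (hxk : x ≤ k + 1) :
    ‖truncError k θ‖ ≤ √(sobolevEnergy γ θ) * x ^ (-γ) := by
  have h_sq : ‖truncError k θ‖ ^ 2 ≤ (x ^ (-γ)) ^ 2 * sobolevEnergy γ θ := by
    refine hasSum_le (fun i => ?_) (hasSum_sq_norm_sq _) (hθ.hasSum.mul_left _)
    rw [truncError_apply]
    split_ifs with hi
    · rw [sq (0 : ℝ), zero_mul]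
      positivity
    · have hxi : x ≤ (i : ℝ) + 1 := hxk.trans (by exact_mod_cast Nat.succ_le_succ (not_lt.1 hi))
      have h_weight : 1 ≤ (x ^ (-γ)) ^ 2 * ((i : ℝ) + 1) ^ (2 * γ) := by
        rw [← Real.rpow_mul_natCast hx.le, Nat.cast_ofNat, neg_mul, mul_comm γ,
          Real.rpow_neg hx.le, ← div_eq_inv_mul, one_le_div₀ (by positivity)]
        gcongr
      rw [mul_left_comm]
      exact le_mul_of_one_le_right (sq_nonneg _) h_weight
  refine le_of_sq_le_sq ?_ (by positivity)
  rwa [mul_pow, Real.sq_sqrt (sobolevEnergy_nonneg γ θ), mul_comm]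

lemma priorDim_le (γ : ℝ) (hc : 0 ≤ c) (n : ℕ) :
    (priorDim γ c n : ℝ) ≤ (n : ℝ) ^ (1 / (2 * γ + 1)) * c :=
  Nat.floor_le (by positivity)

lemma rpow_mul_rpow_neg_eq_rate_mul (γ : ℝ) (hc : 0 ≤ c) (n : ℕ) :
    ((n : ℝ) ^ (1 / (2 * γ + 1)) * c) ^ (-γ) = rate γ n * c ^ (-γ) := by
  rw [Real.mul_rpow (by positivity) hc, ← Real.rpow_mul n.cast_nonneg, rate,
    one_div_mul_eq_div]

lemma natCast_mul_rate_sq (hγ : 0 ≤ γ) (hn : 0 < n) :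
    (n : ℝ) * rate γ n ^ 2 = (n : ℝ) ^ (1 / (2 * γ + 1)) := by
  have hn' : (0 : ℝ) < n := Nat.cast_pos.2 hn
  have h_exponent : 1 / (2 * γ + 1) = 1 + -γ / (2 * γ + 1) * (2 : ℕ) := by
    field_simp
    push_cast
    ring
  rw [rate, ← Real.rpow_mul_natCast hn'.le, h_exponent, Real.rpow_add hn', Real.rpow_one]

lemma eventually_priorDim_le (hγ : 0 < γ) (hc : 0 ≤ c) :
    ∀ᶠ n : ℕ in atTop, priorDim γ c n ≤ n := by
  have h_exponent : 1 / (2 * γ + 1) < 1 := by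
    rw [div_lt_one (by positivity)]
    linarith
  have h_growth : Tendsto (fun n : ℕ => (n : ℝ) ^ (1 - 1 / (2 * γ + 1))) atTop atTop :=
    (tendsto_rpow_atTop (sub_pos.2 h_exponent)).comp tendsto_natCast_atTop_atTop
  filter_upwards [h_growth.eventually_ge_atTop c, eventually_gt_atTop 0] with n hcn hn
  have hn' : (0 : ℝ) < n := Nat.cast_pos.2 hn
  refine (Nat.cast_le (α := ℝ)).1 ((priorDim_le γ hc n).trans ?_)
  calc (n : ℝ) ^ (1 / (2 * γ + 1)) * c
      ≤ (n : ℝ) ^ (1 / (2 * γ + 1)) * (n : ℝ) ^ (1 - 1 / (2 * γ + 1)) := by gcongr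
    _ = n := by rw [← Real.rpow_add hn', add_sub_cancel, Real.rpow_one]

/-- The radius of the contracting balls in units of `rate γ n`, in terms of the constants of
conditions (a) and (c), the constant `c` of the prior dimension and `D = sobolevEnergy γ θ₀`. -/
noncomputable def contractionRadius (γ c a₁ a₂ C D : ℝ) : ℝ :=
  √D * c ^ (-γ) + (√(C * c * D) + √a₂ * (√D * c ^ (-γ)) + 2 * √(8 * c)) / √a₁

lemma contractionRadius_pos (γ : ℝ) {c a₁ : ℝ} (a₂ C D : ℝ) (hc : 0 < c) (ha₁ : 0 < a₁) :
    0 < contractionRadius γ c a₁ a₂ C D := by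
  unfold contractionRadius
  positivity

lemma norm_truncError_priorDim_le (hγ : 0 ≤ γ) (hc : 0 < c) (hθ : CondB γ θ) (hn : 0 < n) :
    ‖truncError (priorDim γ c n) θ‖ ≤ √(sobolevEnergy γ θ) * c ^ (-γ) * rate γ n := by
  have h := norm_truncError_le hγ hθ (by positivity) (Nat.lt_floor_add_one _).le
    (k := priorDim γ c n) (x := (n : ℝ) ^ (1 / (2 * γ + 1)) * c)
  rwa [rpow_mul_rpow_neg_eq_rate_mul γ hc.le, mul_comm (rate γ n), ← mul_assoc] at h

lemma sqrt_precForm_trunc_le {S : Matrix (Fin k) (Fin k) ℝ} {C x : ℝ} (hC : 0 ≤ C)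
    (hS : ∀ α : Fin k → ℝ, precForm S α ≤ C * (k * ∑ i, α i ^ 2 * ((i : ℕ) + 1 : ℝ) ^ (2 * γ)))
    (hkx : k ≤ x) (hθ : CondB γ θ) :
    √(precForm S (trunc k θ)) ≤ √(C * x * sobolevEnergy γ θ) := by
  have h_energy := sum_trunc_le_sobolevEnergy hθ k
  refine Real.sqrt_le_sqrt ((hS _).trans ?_)
  rw [mul_assoc]
  gcongr
  exact k.cast_nonneg.trans hkx

lemma sqrt_precForm_le {Sn : Matrix (Fin n) (Fin n) ℝ} {u : ℝ}
    (hSn_le : ∀ α : Fin n → ℝ, precForm Sn α ≤ u * ∑ i, α i ^ 2)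
    (v : EuclideanSpace ℝ (Fin n)) : √(precForm Sn v) ≤ √u * ‖v‖ := by
  rw [← Real.sqrt_sq (norm_nonneg v), ← Real.sqrt_mul' _ (sq_nonneg _),
    EuclideanSpace.real_norm_sq_eq]
  exact Real.sqrt_le_sqrt (hSn_le _)

lemma oracleRadius_le {Sn : Matrix (Fin n) (Fin n) ℝ}
    {S : Matrix (Fin (priorDim γ c n)) (Fin (priorDim γ c n)) ℝ} {a₁ a₂ C : ℝ} (hγ : 0 ≤ γ)
    (hc : 0 < c) (hn : 0 < n) (ha₁ : 0 < a₁) (hC : 0 ≤ C)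
    (hSn_le : ∀ α : Fin n → ℝ, precForm Sn α ≤ a₂ * (n * ∑ i, α i ^ 2))
    (hS : ∀ α : Fin (priorDim γ c n) → ℝ, precForm S α ≤
      C * (priorDim γ c n * ∑ i, α i ^ 2 * ((i : ℕ) + 1 : ℝ) ^ (2 * γ)))
    (hθ : CondB γ θ) :
    oracleRadius θ Sn S (a₁ * n) (8 * ((n : ℝ) ^ (1 / (2 * γ + 1)) * c)) ≤
      contractionRadius γ c a₁ a₂ C (sobolevEnergy γ θ) * rate γ n := by
  set D := sobolevEnergy γ θ
  set x := (n : ℝ) ^ (1 / (2 * γ + 1)) * c with hx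
  have hn' : (0 : ℝ) < n := Nat.cast_pos.2 hn
  have h_rate : 0 ≤ rate γ n := by unfold rate; positivity
  have h_sqrt {y : ℝ} : √(y * x) = √(y * c) * (√n * rate γ n) := by
    rw [hx, ← natCast_mul_rate_sq hγ hn, ← Real.sqrt_sq h_rate, ← Real.sqrt_mul hn'.le,
      Real.sq_sqrt (sq_nonneg _), ← Real.sqrt_mul' _ (by positivity)]
    congr 1
    ring
  have h_error := norm_truncError_priorDim_le hγ hc hθ hn
  have h_prior : √(precForm S (trunc (priorDim γ c n) θ)) ≤ √(C * c * D) * (√n * rate γ n) := by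
    refine (sqrt_precForm_trunc_le hC hS (priorDim_le γ hc.le n) hθ).trans_eq ?_
    rw [mul_right_comm, h_sqrt, mul_right_comm C]
  have h_bias : √(precForm Sn (trunc n (truncError (priorDim γ c n) θ))) ≤
      √a₂ * (√D * c ^ (-γ)) * (√n * rate γ n) := by
    calc _ ≤ √(a₂ * n) * ‖trunc n (truncError (priorDim γ c n) θ)‖ :=
          sqrt_precForm_le (by simpa only [mul_assoc] using hSn_le) _
      _ ≤ √(a₂ * n) * (√D * c ^ (-γ) * rate γ n) := by
          gcongr
          exact (norm_trunc_le n _).trans h_error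
      _ = _ := by rw [Real.sqrt_mul' _ hn'.le]; ring
  calc oracleRadius θ Sn S (a₁ * n) (8 * x)
      ≤ √D * c ^ (-γ) * rate γ n + (√(C * c * D) * (√n * rate γ n) +
          √a₂ * (√D * c ^ (-γ)) * (√n * rate γ n) + 2 * (√(8 * c) * (√n * rate γ n))) /
            √(a₁ * n) := by
        rw [oracleRadius, h_sqrt]
        gcongr
    _ = contractionRadius γ c a₁ a₂ C D * rate γ n := by
        have := Real.sqrt_pos.2 ha₁
        have := Real.sqrt_pos.2 hn'
        rw [contractionRadius, Real.sqrt_mul ha₁.le]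
        field_simp

lemma summable_exp_neg_rpow_mul {p : ℝ} (hp : 0 < p) (hc : 0 < c) :
    Summable fun n : ℕ => Real.exp (-((n : ℝ) ^ p * c)) := by
  have h_decay := (isLittleO_exp_neg_mul_rpow_atTop hc (-2 / p)).isBigO.comp_tendsto <|
    (tendsto_rpow_atTop hp).comp tendsto_natCast_atTop_atTop
  refine summable_of_isBigO_nat (Real.summable_nat_rpow.2 (by norm_num : (-2 : ℝ) < -1)) ?_
  refine h_decay.congr (fun n => ?_) (fun n => ?_)
  · rw [Function.comp_apply, Function.comp_apply, neg_mul, mul_comm]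
  · rw [Function.comp_apply, Function.comp_apply, ← Real.rpow_mul n.cast_nonneg,
      mul_div_cancel₀ _ hp.ne']

end Rates

lemma ae_tendsto_zero_of_eventually_measure_lt_le {Ω : Type*} [MeasurableSpace Ω] {P : Measure Ω}
    {f : ℕ → Ω → ℝ≥0∞} {a : ℕ → ℝ≥0∞} (ha : ∑' n, a n ≠ ∞)
    (h : ∀ᶠ n in atTop, P {ω | a n < f n ω} ≤ a n) :
    ∀ᵐ ω ∂P, Tendsto (fun n => f n ω) atTop (𝓝 0) := by
  obtain ⟨N, hN⟩ := eventually_atTop.1 h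
  have h_sum : ∑' n, P {ω | a (n + N) < f (n + N) ω} ≠ ∞ := by
    refine ne_top_of_le_ne_top ha ?_
    calc ∑' n, P {ω | a (n + N) < f (n + N) ω}
        ≤ ∑' n, a (n + N) := ENNReal.tsum_le_tsum fun n => hN _ (Nat.le_add_left N n)
      _ ≤ ∑' n, a n := ENNReal.tsum_comp_le_tsum_of_injective (add_left_injective N) a
  have h_zero : Tendsto (fun n => a (n + N)) atTop (𝓝 0) :=
    (tendsto_add_atTop_iff_nat N).2 (ENNReal.tendsto_atTop_zero_of_tsum_ne_top ha)
  filter_upwards [ae_eventually_notMem h_sum] with ω hω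
  rw [← tendsto_add_atTop_iff_nat N]
  refine tendsto_of_tendsto_of_tendsto_of_le_of_le' tendsto_const_nhds h_zero
    (Eventually.of_forall fun _ => zero_le) ?_
  filter_upwards [hω] with n hn
  exact not_lt.1 hn

end InfNormal

theorem theorem7_general {γ : ℝ} (hγ : 0 < γ) {Sig : (n : ℕ) → Matrix (Fin n) (Fin n) ℝ}
    (hSig : ∀ n, (Sig n).PosDef) (ha : CondA Sig) {θ₀ : Param} (hb : CondB γ θ₀) {c : ℝ}
    (hc : 0 < c) {S : (k : ℕ) → Matrix (Fin k) (Fin k) ℝ}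
    (hS : ∀ n, (S (priorDim γ c n)).PosDef) (hprior : CondC γ c S) :
    ∃ r > (0 : ℝ), ∀ (Ω : Type*) [MeasurableSpace Ω] (P : Measure Ω)
      (X : (n : ℕ) → Ω → EuclideanSpace ℝ (Fin n)),
      (∀ n, HasLaw (X n) (multivariateGaussian (trunc n θ₀) (Sig n)) P) →
      ∀ᵐ ω ∂P, Tendsto
        (fun n : ℕ => bayesPosterior (Sig n) (prior (priorDim γ c n) (S (priorDim γ c n)))
          (X n ω) {θ : Param | r * rate γ n ≤ ‖θ - θ₀‖})
        atTop (𝓝 0) := by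
  obtain ⟨a₁, ha₁, a₂, _, hA⟩ := ha
  obtain ⟨C, hC, hC_le⟩ := hprior
  refine ⟨contractionRadius γ c a₁ a₂ C (sobolevEnergy γ θ₀), contractionRadius_pos _ _ _ _ hc ha₁,
    fun Ω _ P X hX => ?_⟩
  set x : ℕ → ℝ := fun n => (n : ℝ) ^ (1 / (2 * γ + 1)) * c
  have h_summable : Summable fun n => Real.exp (-x n) :=
    summable_exp_neg_rpow_mul (by positivity) hc
  refine ae_tendsto_zero_of_eventually_measure_lt_le h_summable.tsum_ofReal_ne_top ?_
  filter_upwards [eventually_gt_atTop 0, eventually_priorDim_le hγ hc.le] with n hn hkn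
  have h_tail : ENNReal.ofReal (chiSqTail (priorDim γ c n) (1 / 4) (8 * x n)) ≤
      ENNReal.ofReal (Real.exp (-x n)) :=
    ENNReal.ofReal_le_ofReal (chiSqTail_le_exp_neg (priorDim_le γ hc.le n))
  have h_radius := oracleRadius_le hγ.le hc hn ha₁ hC.le (fun α => (hA n α).2) (hC_le n) hb
  have h_finite := measure_chiSqTail_lt_bayesPosterior_le (hSig n) (hS n) hkn
    (l := a₁ * n) (s := 1 / 4) (by positivity)
    (fun α => by simpa only [mul_assoc] using (hA n α).1) (hX n)
    (by norm_num) (by norm_num) h_radius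
  exact (measure_mono fun ω hω => h_tail.trans_lt hω).trans (h_finite.trans h_tail)

theorem theorem7
    (γ : ℝ) (hγ : 0 < γ)
    (Sig : (n : ℕ) → Matrix (Fin n) (Fin n) ℝ) (hSig : ∀ n, (Sig n).PosDef)
    (ha : CondA Sig)
    (θ₀ : Param) (hb : CondB γ θ₀) :
    ∃ c > (0 : ℝ),
      ∀ S : (k : ℕ) → Matrix (Fin k) (Fin k) ℝ,
        (∀ n, (S (priorDim γ c n)).PosDef) → CondC γ c S →
        ∃ r > (0 : ℝ),
          ∀ (Ω : Type*) [MeasurableSpace Ω] (P : Measure Ω) [IsProbabilityMeasure P]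
            (X : (n : ℕ) → Ω → EuclideanSpace ℝ (Fin n)),
            (∀ n, HasLaw (X n) (multivariateGaussian (trunc n θ₀) (Sig n)) P) →
            ∀ᵐ ω ∂P, Tendsto
              (fun n : ℕ => bayesPosterior (Sig n) (prior (priorDim γ c n) (S (priorDim γ c n)))
                (X n ω) {θ : Param | r * rate γ n ≤ ‖θ - θ₀‖})
              atTop (𝓝 0) :=
  ⟨1, one_pos, fun _ hS hprior =>
    let ⟨r, hr, h⟩ := theorem7_general hγ hSig ha hb one_pos hS hprior
    ⟨r, hr, fun Ω _ P _ X => h Ω P X⟩⟩
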